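/- A \emph{diagram} is a plane diagram, up to planar isotopy, of an unoriented 4-valent rigid-vertex graph embedded in $\mathbb R^3$; its double points are vertices and crossings, and components that are circles without vertices are allowed. In the formulas below, $[\,\cdot\,]$ of a local picture stands for the value at a diagram containing this picture, and all diagrams in one formula agree outside a disc. For pictures with ends numbered counterclockwise around the disc, write $(ij)$ for an arc joining the ends $i$ and $j$ and $V(ijkl)$ for a vertex joined to the ends $i,j,k,l$; arcs listed together are disjoint. Let $K$ be a field (for instance $K=\mathbb Q(A,B,a)$), let $A,B,a\in K$ with $A\ne B$ and $a\neq 0$, and put $$\mu=\frac{a-a^{-1}}{A-B}+1,\quad \mathcal O=\frac{Aa^{-1}-Ba}{A-B}-(A+B),\quad \gamma=\frac{B^2a-A^2a^{-1}}{A-B}+AB,\quad \xi=\frac{B^3a-A^3a^{-1}}{A-B}.$$ Let $[\,\cdot\,]$ be a function from diagrams to $K$ with the following two properties. (i) Graphical calculus: (1) $[\text{a strand with a crossingless circle beside it}]=\mu\,[\text{strand}]$. (2) $[\text{a strand with a curl whose double point is a vertex}]=\mathcal O\,[\text{strand}]$. (3) If $\beta$ is the picture with four ends $1,2,3,4$ that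 consists of two vertices, one attached to the ends $1,2$ and the other to $3,4$, joined by two edges bounding an empty bigon, then $[\beta]=(1-AB)\,[(14)(23)]+\gamma\,[(12)(34)]-(A+B)\,[V(1234)]$. (4) For six ends, let $\Delta$ (resp. $\Delta'$) be the picture of three vertices spanning an empty triangle, attached to the pairs of ends $12,34,56$ (resp. $23,45,61$). Let $v_{ij}$ be the arc $(ij)$ together with a vertex joined to the other four ends. Then $$[\Delta']-[\Delta]=AB\bigl([v_{23}]-[v_{12}]+[v_{45}]-[v_{34}]+[v_{61}]-[v_{56}]\bigr)+\xi\bigl([(12)(34)(56)]-[(23)(45)(61)]\bigr).$$ (ii) Skein relation: let $\chi$ be the crossing with ends $1$ (bottom left), $2$ (bottom right), $3$ (top right), $4$ (top left) in which the strand from $2$ to $4$ passes over the strand from $1$ to $3$. Then $[\chi]=A\,[(12)(34)]+B\,[(14)(23)]+[V(1234)]$. Then $[\,\cdot\,]$ is invariant under regular isotopy of 4-valent rigid-vertex graphs, that is, under the generalized Reidemeister moves: II (cancelling two crossings of two strands), III (sliding a strand over or under a crossing), IV (sliding a strand over or under a vertex) and V (flipping a rigid vertex, i.e. replacing a vertex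 by crossing--vertex--opposite crossing), and under planar isotopy. Moreover, $[\text{curl}_+]=a\,[\text{strand}]$ and $[\text{curl}_-]=a^{-1}\,[\text{strand}]$, where $\text{curl}_\pm$ is a strand with a curl, to either side, whose crossing has sign $\pm1$ (for either orientation of the strand). -/

import Mathlib

/-!
Diagrams in the plane of unoriented 4-valent rigid-vertex graphs are encoded in Morse position with
respect to the height function: such a diagram is cut by horizontal lines into slices, and each
slice consists of vertical strands and exactly one of: a local minimum (cup), a local maximum (cap),
a vertex, or a crossing.  Vertex-free closed components are allowed.  Every diagram can be put in
this form, and planar isotopy is generated by local rules (see `PlanarRule`).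
-/

namespace RigidGraph

/-- The two crossings of two strands.  `slash`: the strand from bottom left to top right passes
over.  `backslash`: the strand from bottom right to top left passes over. -/
inductive Crossing
  | slash
  | backslash

/-- Switching over and under. -/
def Crossing.opp : Crossing → Crossing
  | .slash => .backslash
  | .backslash => .slash

/-- The 4-valent points of a diagram: rigid vertices and crossings. -/
inductive Node
  | vertex
  | crossing (c : Crossing)

/-- Rotation of a node by a quarter turn: a vertex is unchanged, and the two crossings are
exchanged. -/
def Node.rot : Node → Node
  | .vertex => .vertex
  | .crossing c => .crossing c.opp

/-- The elementary pieces of a diagram. -/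
inductive Gen
  | cup
  | cap
  | node (x : Node)

/-- Number of ends at the bottom. -/
def Gen.dom : Gen → ℕ
  | .cup => 0
  | .cap => 2
  | .node _ => 2

/-- Number of ends at the top. -/
def Gen.cod : Gen → ℕ
  | .cup => 2
  | .cap => 0
  | .node _ => 2

/-- An elementary piece together with the number `pos` of vertical strands to its left. -/
structure Slice where
  gen : Gen
  pos : ℕ

/-- A stack of slices, listed from bottom to top. -/
abbrev Word := List Slice

/-- The number of strands at the top of a stack of slices that starts with `m` strands at the
bottom, or `none` if the slices do not fit. -/
def Word.run : Word → ℕ → Option ℕ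
  | [], m => some m
  | s :: w, m =>
      if s.pos + s.gen.dom ≤ m then Word.run w (m - s.gen.dom + s.gen.cod) else none

/-- Putting `i` more vertical strands to the left. -/
def Word.shift (i : ℕ) (w : Word) : Word :=
  w.map fun s => ⟨s.gen, i + s.pos⟩

theorem Word.run_append (v w : Word) (m : ℕ) :
    Word.run (v ++ w) m = (Word.run v m).bind (Word.run w) := by
  induction v generalizing m with
  | nil => rfl
  | cons s v ih =>
    simp only [List.cons_append, Word.run]
    split
    · exact ih _
    · rfl

theorem Word.run_shift (w : Word) (i r : ℕ) {m n : ℕ} (h : Word.run w m = some n) :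
    Word.run (Word.shift i w) (i + m + r) = some (i + n + r) := by
  induction w generalizing m with
  | nil =>
    simp only [Word.run, Option.some.injEq] at h
    subst h
    rfl
  | cons s w ih =>
    simp only [Word.run] at h
    split at h
    · rename_i hs
      have h' := ih h
      have e : i + m + r - s.gen.dom + s.gen.cod = i + (m - s.gen.dom + s.gen.cod) + r := by
        omega
      simp only [Word.shift, List.map_cons, Word.run]
      rw [if_pos (by omega), e]
      exact h'
    · cases h

/-- A part of a diagram in a box, with `m` ends at the bottom and `n` ends at the top. -/
structure Tangle (m n : ℕ) where
  word : Word
  typed : Word.run word m = some n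

/-- A diagram of a 4-valent rigid-vertex graph: no free ends. -/
abbrev Diagram := Tangle 0 0

/-- A diagram from which the contents of a box with `m` ends at the bottom and `n` ends at the top
have been removed: `left` and `right` strands pass the box, and the rest of the diagram lies below
and above it. -/
structure Frame (m n : ℕ) where
  left : ℕ
  right : ℕ
  below : Tangle 0 (left + m + right)
  above : Tangle (left + n + right) 0

/-- The diagram obtained by inserting `T` into the empty box.  The diagrams `F.fill S` and
`F.fill T` differ only by the local pictures `S` and `T`. -/
def Frame.fill {m n : ℕ} (F : Frame m n) (T : Tangle m n) : Diagram where
  word := F.below.word ++ (Word.shift F.left T.word ++ F.above.word)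
  typed := by
    rw [Word.run_append, F.below.typed, Option.bind_some, Word.run_append,
      Word.run_shift _ _ _ T.typed, Option.bind_some, F.above.typed]

/-- A local minimum with `i` strands to its left. -/
def cup (i : ℕ) : Slice := ⟨.cup, i⟩

/-- A local maximum with `i` strands to its left. -/
def cap (i : ℕ) : Slice := ⟨.cap, i⟩

/-- A vertex or a crossing with `i` strands to its left. -/
def nd (x : Node) (i : ℕ) : Slice := ⟨.node x, i⟩

/-- A vertex with `i` strands to its left. -/
def vx (i : ℕ) : Slice := nd .vertex i

/-- A crossing with `i` strands to its left. -/
def cr (c : Crossing) (i : ℕ) : Slice := nd (.crossing c) i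

/-- `n` vertical strands. -/
def strands (n : ℕ) : Tangle n n := ⟨[], rfl⟩

/-- The local rules of planar isotopy. -/
inductive PlanarRule : ∀ {m n : ℕ}, Tangle m n → Tangle m n → Prop
  /-- Two pieces side by side exchange their heights. -/
  | interchange (g h : Gen) (d : ℕ) :
      PlanarRule
        (⟨[⟨g, 0⟩, ⟨h, g.cod + d⟩], by
            simp only [Word.run]
            rw [if_pos (by omega), if_pos (by omega)]
            congr 1
            omega⟩ :
          Tangle (g.dom + d + h.dom) (g.cod + d + h.cod))
        ⟨[⟨h, g.dom + d⟩, ⟨g, 0⟩], by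
            simp only [Word.run]
            rw [if_pos (by omega), if_pos (by omega)]
            congr 1
            omega⟩
  /-- A maximum and a minimum on the same strand cancel (two mirror images). -/
  | zigzag_left : PlanarRule (⟨[cup 1, cap 0], rfl⟩ : Tangle 1 1) (strands 1)
  | zigzag_right : PlanarRule (⟨[cup 0, cap 1], rfl⟩ : Tangle 1 1) (strands 1)
  /-- A node next to a maximum makes a quarter turn. -/
  | turn_cap (x : Node) :
      PlanarRule (⟨[nd x 0, cap 1], rfl⟩ : Tangle 3 1) ⟨[nd x.rot 1, cap 0], rfl⟩
  /-- A node next to a minimum makes a quarter turn. -/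
  | turn_cup (x : Node) :
      PlanarRule (⟨[cup 1, nd x 0], rfl⟩ : Tangle 1 3) ⟨[cup 0, nd x.rot 1], rfl⟩

/-- The generalized Reidemeister moves II to V; with planar isotopy available, all rotated versions
of these moves follow from the ones listed. -/
inductive ReidemeisterRule : ∀ {m n : ℕ}, Tangle m n → Tangle m n → Prop
  /-- Two strands are pulled apart. -/
  | move_II (c : Crossing) :
      ReidemeisterRule (⟨[cr c 0, cr c.opp 0], rfl⟩ : Tangle 2 2) (strands 2)
  /-- A strand slides over (`c = slash`) or under (`c = backslash`) a crossing `y`. -/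
  | move_III (c y : Crossing) :
      ReidemeisterRule (⟨[cr c 0, cr c 1, cr y 0], rfl⟩ : Tangle 3 3)
        ⟨[cr y 1, cr c 0, cr c 1], rfl⟩
  /-- A strand slides over (`c = slash`) or under (`c = backslash`) a vertex. -/
  | move_IV (c : Crossing) :
      ReidemeisterRule (⟨[cr c 0, cr c 1, vx 0], rfl⟩ : Tangle 3 3)
        ⟨[vx 1, cr c 0, cr c 1], rfl⟩
  /-- A rigid vertex is flipped over. -/
  | move_V (c : Crossing) :
      ReidemeisterRule (⟨[cr c 0, vx 0, cr c.opp 0], rfl⟩ : Tangle 2 2) ⟨[vx 0], rfl⟩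

/-- Two diagrams are the same except for one application of a planar rule. -/
def PlanarStep (D E : Diagram) : Prop :=
  ∃ (m n : ℕ) (F : Frame m n) (S T : Tangle m n),
    PlanarRule S T ∧ D = F.fill S ∧ E = F.fill T

/-- Two diagrams are the same except for one application of a Reidemeister move II to V. -/
def ReidemeisterStep (D E : Diagram) : Prop :=
  ∃ (m n : ℕ) (F : Frame m n) (S T : Tangle m n),
    ReidemeisterRule S T ∧ D = F.fill S ∧ E = F.fill T

/-- Planar isotopy of diagrams. -/
def PlanarIsotopic : Diagram → Diagram → Prop :=
  Relation.EqvGen PlanarStep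

/-- Regular isotopy of diagrams: planar isotopy and the moves II to V. -/
def RegularlyIsotopic : Diagram → Diagram → Prop :=
  Relation.EqvGen fun D E => PlanarStep D E ∨ ReidemeisterStep D E

section Calculus

variable {K : Type*} [Field K]

/-- The coefficient `μ`. -/
def mu (A B a : K) : K := (a - a⁻¹) / (A - B) + 1

/-- The coefficient written as a calligraphic O. -/
def loopCoeff (A B a : K) : K := (A * a⁻¹ - B * a) / (A - B) - (A + B)

/-- The coefficient `γ`. -/
def gam (A B a : K) : K := (B ^ 2 * a - A ^ 2 * a⁻¹) / (A - B) + A * B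

/-- The coefficient `ξ`. -/
def xi (A B a : K) : K := (B ^ 3 * a - A ^ 3 * a⁻¹) / (A - B)

/-- A strand with a circle beside it. -/
def circleBeside : Tangle 1 1 := ⟨[cup 1, cap 1], rfl⟩

/-- A strand with a curl (to the right) whose double point is the node `x`. -/
def curlRight (x : Node) : Tangle 1 1 := ⟨[cup 1, nd x 0, cap 1], rfl⟩

/-- A strand with a curl (to the left) whose double point is the node `x`. -/
def curlLeft (x : Node) : Tangle 1 1 := ⟨[cup 0, nd x 1, cap 0], rfl⟩

/-- One node. -/
def single (x : Node) : Tangle 2 2 := ⟨[nd x 0], rfl⟩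

/-- The two horizontal arcs: the bottom ends are joined, and the top ends are joined. -/
def horizontal : Tangle 2 2 := ⟨[cap 0, cup 0], rfl⟩

/-- Two vertices joined by two edges that bound an empty bigon. -/
def bigon : Tangle 2 2 := ⟨[vx 0, vx 0], rfl⟩

/-! Pictures with six ends, numbered counterclockwise: 1, 2, 3 at the bottom from left to right, and
4, 5, 6 at the top from right to left. -/

/-- Three vertices spanning a triangle, attached to the pairs of ends 12, 34 and 56. -/
def triangle12 : Tangle 3 3 := ⟨[vx 0, vx 1, vx 0], rfl⟩

/-- Three vertices spanning a triangle, attached to the pairs of ends 23, 45 and 61. -/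
def triangle23 : Tangle 3 3 := ⟨[vx 1, vx 0, vx 1], rfl⟩

/-- An arc joining 1 and 2; the other ends are joined to a vertex. -/
def arc12 : Tangle 3 3 := ⟨[cap 0, cup 1, vx 0], rfl⟩

/-- An arc joining 2 and 3; the other ends are joined to a vertex. -/
def arc23 : Tangle 3 3 := ⟨[cap 1, cup 1, vx 0], rfl⟩

/-- An arc joining 3 and 4; the other ends are joined to a vertex. -/
def arc34 : Tangle 3 3 := ⟨[vx 0], rfl⟩

/-- An arc joining 4 and 5; the other ends are joined to a vertex. -/
def arc45 : Tangle 3 3 := ⟨[vx 0, cap 1, cup 1], rfl⟩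

/-- An arc joining 5 and 6; the other ends are joined to a vertex. -/
def arc56 : Tangle 3 3 := ⟨[vx 0, cap 1, cup 0], rfl⟩

/-- An arc joining 6 and 1; the other ends are joined to a vertex. -/
def arc61 : Tangle 3 3 := ⟨[vx 1], rfl⟩

/-- Three arcs joining 12, 34 and 56. -/
def arcs12 : Tangle 3 3 := ⟨[cap 0, cup 0], rfl⟩

/-- Three arcs joining 23, 45 and 61. -/
def arcs23 : Tangle 3 3 := ⟨[cap 1, cup 1], rfl⟩

/-- The four identities of the graphical calculus. -/
structure GraphicalCalculus (A B a : K) (P : Diagram → K) : Prop where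
  circle : ∀ F : Frame 1 1, P (F.fill circleBeside) = mu A B a * P (F.fill (strands 1))
  loop : ∀ F : Frame 1 1,
    P (F.fill (curlRight .vertex)) = loopCoeff A B a * P (F.fill (strands 1))
  bigon : ∀ F : Frame 2 2,
    P (F.fill bigon) = (1 - A * B) * P (F.fill (strands 2)) + gam A B a * P (F.fill horizontal)
      - (A + B) * P (F.fill (single .vertex))
  triangle : ∀ F : Frame 3 3,
    P (F.fill triangle23) - P (F.fill triangle12) =
      A * B * (P (F.fill arc23) - P (F.fill arc12) + P (F.fill arc45) - P (F.fill arc34)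
        + P (F.fill arc61) - P (F.fill arc56))
      + xi A B a * (P (F.fill arcs12) - P (F.fill arcs23))

/-- The skein relation. -/
def SkeinRelation (A B : K) (P : Diagram → K) : Prop :=
  ∀ F : Frame 2 2,
    P (F.fill (single (.crossing .backslash))) =
      A * P (F.fill horizontal) + B * P (F.fill (strands 2)) + P (F.fill (single .vertex))

end Calculus

end RigidGraph

namespace RigidGraph

/-! The skein relation, together with its quarter turn, writes every crossing as a combination of
the vertical strands, the horizontal arcs and a vertex (`SkeinRelation.expands`). Each side of a
move thus becomes a combination of crossingless pictures. Circles, loops and bigons are removed by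
the calculus, and the remaining coefficients are compared.

They agree because of four identities: Aμ + B + O = a and Bμ + A + O = a⁻¹ give the curls; γ = -(A²
+ B² + ABμ + (A + B)O) kills the horizontal term in move II; ξ = AB·O + (A + B)γ is the coefficient
that the triangle relation must correct in move IV. Moves II and IV are computed directly. Move V
follows from II because a crossing commutes with a vertex stacked on it. Move III follows by
expanding only the crossing that is passed: its vertex term is IV and its horizontal term is II used
twice. -/

/-! ### Relations applied inside a larger picture. -/

/-- A word inserted between two words, with `j` and `r` additional strands beside it. -/
def Tangle.ctx {m n k l : ℕ} (T : Tangle k l) (x z : Word) (j r : ℕ)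
    (hx : Word.run x m = some (j + k + r)) (hz : Word.run z (j + l + r) = some n) :
    Tangle m n where
  word := x ++ (Word.shift j T.word ++ z)
  typed := by
    rw [Word.run_append, hx, Option.bind_some, Word.run_append,
      Word.run_shift _ _ _ T.typed, Option.bind_some, hz]

/-- The frame obtained by filling a part of the box. -/
def Frame.nest {m n k l : ℕ} (F : Frame m n) (x z : Word) (j r : ℕ)
    (hx : Word.run x m = some (j + k + r)) (hz : Word.run z (j + l + r) = some n) :
    Frame k l where
  left := F.left + j
  right := r + F.right
  below := ⟨F.below.word ++ Word.shift F.left x, by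
    rw [Word.run_append, F.below.typed, Option.bind_some, Word.run_shift x F.left F.right hx]
    congr 1
    omega⟩
  above := ⟨Word.shift F.left z ++ F.above.word, by
    rw [Word.run_append,
      show F.left + j + l + (r + F.right) = F.left + (j + l + r) + F.right by omega,
      Word.run_shift z F.left F.right hz, Option.bind_some, F.above.typed]⟩

theorem Tangle.word_injective {m n : ℕ} {S T : Tangle m n} (h : S.word = T.word) : S = T := by
  cases S
  cases T
  cases h
  rfl

/-- Lets a relation assumed for all frames be used on any part of a local picture: the surrounding
part is absorbed into the frame. -/
theorem Frame.fill_nest {m n k l : ℕ} (F : Frame m n) (x z : Word) (j r : ℕ)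
    (hx : Word.run x m = some (j + k + r)) (hz : Word.run z (j + l + r) = some n)
    (T : Tangle k l) : (F.nest x z j r hx hz).fill T = F.fill (T.ctx x z j r hx hz) := by
  apply Tangle.word_injective
  simp [Frame.fill, Frame.nest, Tangle.ctx, Word.shift, Function.comp_def, add_assoc]

theorem Crossing.opp_opp (c : Crossing) : c.opp.opp = c := by
  cases c <;> rfl

section

variable {K : Type*}

/-- Two local pictures that have the same value in every frame. -/
def Same (P : Diagram → K) {m n : ℕ} (S T : Tangle m n) : Prop :=
  ∀ F : Frame m n, P (F.fill S) = P (F.fill T)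

variable {P : Diagram → K} {m n k l : ℕ}

theorem Same.symm {S T : Tangle m n} (h : Same P S T) : Same P T S := fun F => (h F).symm

theorem Same.trans {S T U : Tangle m n} (h : Same P S T) (h' : Same P T U) : Same P S U :=
  fun F => (h F).trans (h' F)

theorem Same.ctx {S T : Tangle k l} (h : Same P S T) (x z : Word) (j r : ℕ)
    (hx : Word.run x m = some (j + k + r)) (hz : Word.run z (j + l + r) = some n) :
    Same P (S.ctx x z j r hx hz) (T.ctx x z j r hx hz) := fun F => by
  rw [← Frame.fill_nest, ← Frame.fill_nest]
  exact h _

/-- Invariance under planar isotopy. -/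
def PlanarInvariant (P : Diagram → K) : Prop :=
  ∀ D E : Diagram, PlanarIsotopic D E → P D = P E

theorem PlanarInvariant.same (hP : PlanarInvariant P) {S T : Tangle m n} (h : PlanarRule S T) :
    Same P S T := fun F =>
  hP _ _ (Relation.EqvGen.rel _ _ ⟨m, n, F, S, T, h, rfl, rfl⟩)

end

/-! ### Planar isotopies of small pictures. -/

section Planar

variable {K : Type*} {P : Diagram → K}

/-- A node below a minimum is rotated by conjugation with bent strands. -/
theorem same_node_rot (hP : PlanarInvariant P) (x : Node) :
    Same P (single x.rot) ⟨[cup 0, nd x 1, cap 2], rfl⟩ :=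
  (((hP.same .zigzag_right).ctx (m := 2) (n := 2) [nd x.rot 0] [] 0 1 rfl rfl).symm.trans
    ((hP.same (.interchange .cup (.node x.rot) 0)).ctx (m := 2) (n := 2)
      [] [cap 1] 0 0 rfl rfl).symm).trans
    ((hP.same (.turn_cap x)).ctx (m := 2) (n := 2) [cup 0] [] 1 0 rfl rfl).symm

/-- With `same_bent_horizontal`: the quarter turn of `same_node_rot` exchanges the two smoothings.
-/
theorem same_bent_strands (hP : PlanarInvariant P) :
    Same P ⟨[cup 0, cap 2], rfl⟩ horizontal :=
  (hP.same (.interchange .cup .cap 0))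

theorem same_bent_horizontal (hP : PlanarInvariant P) :
    Same P ⟨[cup 0, cap 1, cup 1, cap 2], rfl⟩ (strands 2) :=
  ((hP.same .zigzag_right).ctx (m := 2) (n := 2) [] [cup 1, cap 2] 0 1 rfl rfl).trans
    ((hP.same .zigzag_right).ctx (m := 2) (n := 2) [] [] 1 0 rfl rfl)

/-- A vertex whose lower ends are joined, from a curl bent downwards. -/
theorem same_cup_node (hP : PlanarInvariant P) (x : Node) :
    Same P ⟨[cup 0, nd x 0], rfl⟩
      ((⟨[cup 1, nd x 1, cap 0], rfl⟩ : Tangle 1 1).ctx (m := 0) (n := 2)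
        [cup 0] [] 1 0 rfl rfl) :=
  -- A zigzag is created on the upper left end; its minimum then slides below the node and below the
  -- old minimum.
  (((hP.same .zigzag_right).ctx (m := 0) (n := 2) [cup 0, nd x 0] [] 0 1 rfl rfl).symm.trans
    ((hP.same (.interchange .cup (.node x) 0)).ctx (m := 0) (n := 2)
      [cup 0] [cap 1] 0 0 rfl rfl).symm).trans
    ((hP.same (.interchange .cup .cup 0)).ctx (m := 0) (n := 2)
      [] [nd x 2, cap 1] 0 0 rfl rfl).symm

/-- A vertex whose upper ends are joined, from a curl bent upwards. -/
theorem same_node_cap (hP : PlanarInvariant P) (x : Node) :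
    Same P ⟨[nd x 0, cap 0], rfl⟩
      ((⟨[cup 0, nd x 1, cap 1], rfl⟩ : Tangle 1 1).ctx (m := 2) (n := 0)
        [] [cap 0] 1 0 rfl rfl) :=
  (((hP.same .zigzag_left).ctx (m := 2) (n := 0) [] [nd x 0, cap 0] 0 1 rfl rfl).symm.trans
    ((hP.same (.interchange .cap (.node x) 0)).ctx (m := 2) (n := 0)
      [cup 1] [cap 0] 0 0 rfl rfl)).trans
    ((hP.same (.interchange .cap .cap 0)).ctx (m := 2) (n := 0)
      [cup 1, nd x 2] [] 0 0 rfl rfl)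

theorem same_curlRight (hP : PlanarInvariant P) (x : Node) :
    Same P (curlRight x) ⟨[cup 0, nd x.rot 1, cap 1], rfl⟩ :=
  (hP.same (.turn_cup x)).ctx (m := 1) (n := 1) [] [cap 1] 0 0 rfl rfl

theorem same_curlRight' (hP : PlanarInvariant P) (x : Node) :
    Same P (curlRight x) ⟨[cup 1, nd x.rot 1, cap 0], rfl⟩ :=
  (hP.same (.turn_cap x)).ctx (m := 1) (n := 1) [cup 1] [] 0 0 rfl rfl

theorem same_curlLeft (hP : PlanarInvariant P) (x : Node) :
    Same P (curlLeft x.rot) ⟨[cup 1, nd x 0, cap 0], rfl⟩ :=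
  ((hP.same (.turn_cup x)).ctx (m := 1) (n := 1) [] [cap 0] 0 0 rfl rfl).symm

/-- A circle to the left of a strand, from a circle to its right. -/
theorem same_circle_left (hP : PlanarInvariant P) :
    Same P ⟨[cup 0, cap 0], rfl⟩
      (circleBeside.ctx (m := 1) (n := 1) [cup 1] [cap 0] 1 1 rfl rfl) :=
  -- The strand is bent into a zigzag, so that the circle comes to lie to the right of the middle
  -- leg.
  (((hP.same .zigzag_left).ctx (m := 1) (n := 1) [] [cup 0, cap 0] 0 0 rfl rfl).symm.trans
    ((hP.same (.interchange .cap .cup 0)).ctx (m := 1) (n := 1)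
      [cup 1] [cap 0] 0 1 rfl rfl)).trans
    ((hP.same (.interchange .cap .cap 0)).ctx (m := 1) (n := 1)
      [cup 1, cup 2] [] 0 1 rfl rfl)

theorem same_circle_cup (hP : PlanarInvariant P) :
    Same P ⟨[cup 0, cap 0, cup 0], rfl⟩
      ((⟨[cup 0, cap 0], rfl⟩ : Tangle 1 1).ctx (m := 0) (n := 2) [cup 0] [] 0 1 rfl rfl) :=
  ((hP.same (.interchange .cap .cup 0)).ctx (m := 0) (n := 2) [cup 0] [] 0 0 rfl rfl).trans
    ((hP.same (.interchange .cup .cup 0)).ctx (m := 0) (n := 2) [] [cap 0] 0 0 rfl rfl)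

end Planar

/-! ### Identities between the coefficients. -/

section Coefficients

variable {K : Type*} [Field K] {A B a : K}

theorem mul_mu_add (hAB : A ≠ B) : A * mu A B a + B + loopCoeff A B a = a := by
  have h : A - B ≠ 0 := sub_ne_zero.mpr hAB
  unfold mu loopCoeff
  -- The identity is linear in a and a⁻¹, which may be treated as independent.
  generalize a⁻¹ = b
  field_simp
  ring

theorem mul_mu_add' (hAB : A ≠ B) : B * mu A B a + A + loopCoeff A B a = a⁻¹ := by
  have h : A - B ≠ 0 := sub_ne_zero.mpr hAB
  unfold mu loopCoeff
  generalize a⁻¹ = b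
  field_simp
  ring

/-- This is the vanishing of the coefficient of the horizontal arcs in the expansion of move II. -/
theorem gam_eq (hAB : A ≠ B) :
    gam A B a = -(A ^ 2 + B ^ 2 + A * B * mu A B a + (A + B) * loopCoeff A B a) := by
  have h : A - B ≠ 0 := sub_ne_zero.mpr hAB
  unfold mu loopCoeff gam
  generalize a⁻¹ = b
  field_simp
  ring

/-- The right side is the coefficient of `arcs12` on the left of move IV, and of `arcs23` on its
right. -/
theorem xi_eq (hAB : A ≠ B) :
    xi A B a = A * B * loopCoeff A B a + (A + B) * gam A B a := by
  have h : A - B ≠ 0 := sub_ne_zero.mpr hAB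
  unfold xi loopCoeff gam
  generalize a⁻¹ = b
  field_simp
  ring

/-- The coefficient of the vertical strands in the expansion of a crossing. -/
def smoothing (A B : K) : Crossing → K
  | .slash => A
  | .backslash => B

/-- With `smoothing_add`: the moves need only the product and the sum of the two smoothing
coefficients, so both crossings are treated at once. -/
theorem smoothing_mul (c : Crossing) : smoothing A B c * smoothing A B c.opp = A * B := by
  cases c <;> simp [smoothing, Crossing.opp, mul_comm]

theorem smoothing_add (c : Crossing) : smoothing A B c + smoothing A B c.opp = A + B := by
  cases c <;> simp [smoothing, Crossing.opp, add_comm]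

end Coefficients

/-! ### Skein expansion and consequences of the calculus. -/

section Relations

variable {K : Type*} [Field K] {P : Diagram → K} {m n k l : ℕ}

/-- The value of a local picture in a frame. -/
def value (P : Diagram → K) (F : Frame m n) (w : Word) (h : Word.run w m = some n := by rfl) :
    K :=
  P (F.fill ⟨w, h⟩)

/-- The first local picture has `c` times the value of the second one. -/
def Scales (P : Diagram → K) (c : K) (S T : Tangle m n) : Prop :=
  ∀ F : Frame m n, P (F.fill S) = c * P (F.fill T)

theorem Scales.ctx {c : K} {S T : Tangle k l} (h : Scales P c S T) (x z : Word) (j r : ℕ)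
    (hx : Word.run x m = some (j + k + r)) (hz : Word.run z (j + l + r) = some n) :
    Scales P c (S.ctx x z j r hx hz) (T.ctx x z j r hx hz) := fun F => by
  rw [← Frame.fill_nest, ← Frame.fill_nest]
  exact h _

theorem Same.trans_scales {c : K} {S T U : Tangle m n} (h : Same P S T) (h' : Scales P c T U) :
    Scales P c S U := fun F => (h F).trans (h' F)

theorem Scales.trans_same {c : K} {S T U : Tangle m n} (h : Scales P c S T) (h' : Same P T U) :
    Scales P c S U := fun F => by rw [h F, h' F]

/-- A 4-ended picture is a combination of the vertical strands, the horizontal arcs and the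
vertex. -/
def Expands (P : Diagram → K) (S : Tangle 2 2) (c d e : K) : Prop :=
  ∀ F : Frame 2 2, P (F.fill S) =
    c * P (F.fill (strands 2)) + d * P (F.fill horizontal) + e * P (F.fill (single .vertex))

theorem Expands.ctx {c d e : K} {S : Tangle 2 2} (h : Expands P S c d e) (F : Frame m n)
    (x z : Word) (j r : ℕ)
    (hx : Word.run x m = some (j + 2 + r)) (hz : Word.run z (j + 2 + r) = some n) :
    P (F.fill (S.ctx x z j r hx hz)) = c * P (F.fill ((strands 2).ctx x z j r hx hz))
      + d * P (F.fill (horizontal.ctx x z j r hx hz))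
      + e * P (F.fill ((single .vertex).ctx x z j r hx hz)) := by
  simp only [← Frame.fill_nest]
  exact h _

variable {A B a : K}

theorem GraphicalCalculus.expands_bigon (hc : GraphicalCalculus A B a P) :
    Expands P RigidGraph.bigon (1 - A * B) (gam A B a) (-(A + B)) := fun F => by
  rw [hc.bigon F]
  ring

/-- The assumed relation concerns `backslash` only. Turning it by a quarter swaps the smoothings,
hence A and B, and gives `slash`. -/
theorem SkeinRelation.expands (hs : SkeinRelation A B P) (hP : PlanarInvariant P)
    (c : Crossing) :
    Expands P (single (.crossing c)) (smoothing A B c) (smoothing A B c.opp) 1 := by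
  have hb : Expands P (single (.crossing .backslash)) B A 1 := fun F => by
    rw [hs F]
    ring
  cases c with
  | backslash => exact hb
  | slash =>
    intro F
    have h := hb.ctx F [cup 0] [cap 2] 1 1 rfl rfl
    have h1 := same_node_rot hP (.crossing .backslash) F
    have h2 := same_node_rot hP .vertex F
    have h3 := same_bent_strands hP F
    have h4 := same_bent_horizontal hP F
    refine h1.trans (h.trans ?_)
    refine (congrArg₂ (· + ·) (congrArg₂ (· + ·) (congrArg (B * ·) h3) (congrArg (A * ·) h4))
      (congrArg (1 * ·) h2.symm)).trans ?_
    simp only [smoothing, Crossing.opp]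
    exact congrArg (· + _) (add_comm _ _)

theorem GraphicalCalculus.loop_cup (hc : GraphicalCalculus A B a P) (hP : PlanarInvariant P) :
    Scales P (loopCoeff A B a) (⟨[cup 0, vx 0], rfl⟩ : Tangle 0 2) ⟨[cup 0], rfl⟩ :=
  (same_cup_node hP .vertex).trans_scales
    (((same_curlRight' hP .vertex).symm.trans_scales hc.loop).ctx [cup 0] [] 1 0 rfl rfl)

theorem GraphicalCalculus.loop_cap (hc : GraphicalCalculus A B a P) (hP : PlanarInvariant P) :
    Scales P (loopCoeff A B a) (⟨[vx 0, cap 0], rfl⟩ : Tangle 2 0) ⟨[cap 0], rfl⟩ :=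
  (same_node_cap hP .vertex).trans_scales
    (((same_curlRight hP .vertex).symm.trans_scales hc.loop).ctx [] [cap 0] 1 0 rfl rfl)

theorem GraphicalCalculus.loop_left (hc : GraphicalCalculus A B a P) (hP : PlanarInvariant P) :
    Scales P (loopCoeff A B a) (⟨[cup 1, vx 0, cap 0], rfl⟩ : Tangle 1 1) (strands 1) :=
  ((hc.loop_cap hP).ctx (m := 1) (n := 1) [cup 1] [] 0 1 rfl rfl).trans_same
    (hP.same .zigzag_left)

theorem GraphicalCalculus.circle_left (hc : GraphicalCalculus A B a P)
    (hP : PlanarInvariant P) :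
    Scales P (mu A B a) (⟨[cup 0, cap 0], rfl⟩ : Tangle 1 1) (strands 1) :=
  ((same_circle_left hP).trans_scales
    (Scales.ctx (m := 1) (n := 1) (c := mu A B a) hc.circle [cup 1] [cap 0] 1 1 rfl rfl)).trans_same
    (hP.same .zigzag_left)

theorem GraphicalCalculus.circle_cup (hc : GraphicalCalculus A B a P)
    (hP : PlanarInvariant P) :
    Scales P (mu A B a) (⟨[cup 0, cap 0, cup 0], rfl⟩ : Tangle 0 2) ⟨[cup 0], rfl⟩ :=
  (same_circle_cup hP).trans_scales
    ((hc.circle_left hP).ctx (m := 0) (n := 2) [cup 0] [] 0 1 rfl rfl)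

end Relations

/-! ### Invariance under the moves, and the curls. -/

section Moves

variable {K : Type*} [Field K] {P : Diagram → K} {A B a : K}

theorem same_move_II (hAB : A ≠ B) (hP : PlanarInvariant P) (hc : GraphicalCalculus A B a P)
    (hs : SkeinRelation A B P) (c : Crossing) :
    Same P (⟨[cr c 0, cr c.opp 0], rfl⟩ : Tangle 2 2) (strands 2) := by
  intro F
  have e := hs.expands hP c
  have e' := hs.expands hP c.opp
  rw [Crossing.opp_opp] at e'
  -- A context of explicit words computes to an explicit word, so such equations hold by unfolding;
  -- each `_` is read off from the relation used.
  have h0 : value P F [cr c 0, cr c.opp 0] = _ * value P F [cr c.opp 0]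
      + _ * value P F [cap 0, cup 0, cr c.opp 0] + 1 * value P F [vx 0, cr c.opp 0] :=
    e.ctx F [] [cr c.opp 0] 0 0 rfl rfl
  have h1 : value P F [cr c.opp 0] = _ * value P F [] + _ * value P F [cap 0, cup 0]
      + 1 * value P F [vx 0] := e' F
  have h2 : value P F [cap 0, cup 0, cr c.opp 0] = _ * value P F [cap 0, cup 0]
      + _ * value P F [cap 0, cup 0, cap 0, cup 0] + 1 * value P F [cap 0, cup 0, vx 0] :=
    e'.ctx F [cap 0, cup 0] [] 0 0 rfl rfl
  have h3 : value P F [vx 0, cr c.opp 0] = _ * value P F [vx 0]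
      + _ * value P F [vx 0, cap 0, cup 0] + 1 * value P F [vx 0, vx 0] :=
    e'.ctx F [vx 0] [] 0 0 rfl rfl
  have h4 : value P F [cap 0, cup 0, cap 0, cup 0] = _ * value P F [cap 0, cup 0] :=
    (hc.circle_cup hP).ctx [cap 0] [] 0 0 rfl rfl F
  have h5 : value P F [cap 0, cup 0, vx 0] = _ * value P F [cap 0, cup 0] :=
    (hc.loop_cup hP).ctx [cap 0] [] 0 0 rfl rfl F
  have h6 : value P F [vx 0, cap 0, cup 0] = _ * value P F [cap 0, cup 0] :=
    (hc.loop_cap hP).ctx [] [cup 0] 0 0 rfl rfl F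
  have h7 : value P F [vx 0, vx 0] = _ * value P F [] + _ * value P F [cap 0, cup 0]
      + _ * value P F [vx 0] := hc.expands_bigon F
  change value P F [cr c 0, cr c.opp 0] = value P F []
  rw [h0, h1, h2, h3, h4, h5, h6, h7, gam_eq hAB]
  have hm := smoothing_mul (A := A) (B := B) c
  have ha := smoothing_add (A := A) (B := B) c
  generalize smoothing A B c = p at *
  generalize smoothing A B c.opp = q at *
  -- A² + B² is put in terms of A + B and AB, the only links left between A, B and p, q.
  rw [← hm, ← ha, show A ^ 2 + B ^ 2 = (A + B) ^ 2 - 2 * (A * B) by ring, ← hm, ← ha]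
  ring

theorem value_curlRight (hP : PlanarInvariant P) (hc : GraphicalCalculus A B a P)
    (hs : SkeinRelation A B P) (c : Crossing) (F : Frame 1 1) :
    P (F.fill (curlRight (.crossing c))) =
      (smoothing A B c * mu A B a + smoothing A B c.opp + loopCoeff A B a)
        * P (F.fill (strands 1)) := by
  have h0 : value P F [cup 1, cr c 0, cap 1] = _ * value P F [cup 1, cap 1]
      + _ * value P F [cup 1, cap 0, cup 0, cap 1] + 1 * value P F [cup 1, vx 0, cap 1] :=
    (hs.expands hP c).ctx F [cup 1] [cap 1] 0 1 rfl rfl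
  have h1 : value P F [cup 1, cap 1] = _ * value P F [] := hc.circle F
  have h2 : value P F [cup 1, vx 0, cap 1] = _ * value P F [] := hc.loop F
  have h3 : value P F [cup 1, cap 0, cup 0, cap 1] = value P F [] :=
    (((hP.same .zigzag_left).ctx [] [cup 0, cap 1] 0 0 rfl rfl).trans
      (hP.same .zigzag_right)) F
  change value P F [cup 1, cr c 0, cap 1] = _ * value P F []
  rw [h0, h1, h2, h3]
  ring

/-- After a quarter turn it is the horizontal smoothing that splits off a circle, while the vertical
one leaves a zigzag. -/
theorem value_curlLeft (hP : PlanarInvariant P) (hc : GraphicalCalculus A B a P)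
    (hs : SkeinRelation A B P) (c : Crossing) (F : Frame 1 1) :
    P (F.fill (curlLeft (.crossing c.opp))) =
      (smoothing A B c + smoothing A B c.opp * mu A B a + loopCoeff A B a)
        * P (F.fill (strands 1)) := by
  have h0 : value P F [cup 1, cr c 0, cap 0] = _ * value P F [cup 1, cap 0]
      + _ * value P F [cup 1, cap 0, cup 0, cap 0] + 1 * value P F [cup 1, vx 0, cap 0] :=
    (hs.expands hP c).ctx F [cup 1] [cap 0] 0 1 rfl rfl
  have h1 : value P F [cup 1, cap 0] = value P F [] := hP.same .zigzag_left F
  have h2 : value P F [cup 1, vx 0, cap 0] = _ * value P F [] := hc.loop_left hP F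
  have h3 : value P F [cup 1, cap 0, cup 0, cap 0] = _ * value P F [] :=
    (((hP.same .zigzag_left).ctx [] [cup 0, cap 0] 0 0 rfl rfl).trans_scales
      (hc.circle_left hP)) F
  refine (same_curlLeft hP (.crossing c) F).trans ?_
  change value P F [cup 1, cr c 0, cap 0] = _ * value P F []
  rw [h0, h1, h2, h3]
  ring

theorem same_move_V (hAB : A ≠ B) (hP : PlanarInvariant P) (hc : GraphicalCalculus A B a P)
    (hs : SkeinRelation A B P) (c : Crossing) :
    Same P (⟨[cr c 0, vx 0, cr c.opp 0], rfl⟩ : Tangle 2 2) ⟨[vx 0], rfl⟩ := by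
  -- Horizontal arcs absorb a vertex from above or from below with the same factor, so both orders
  -- have the same expansion.
  have comm : Same P (⟨[cr c 0, vx 0], rfl⟩ : Tangle 2 2) ⟨[vx 0, cr c 0], rfl⟩ := by
    intro F
    have h1 : value P F [cr c 0, vx 0] = _ * value P F [vx 0]
        + _ * value P F [cap 0, cup 0, vx 0] + 1 * value P F [vx 0, vx 0] :=
      (hs.expands hP c).ctx F [] [vx 0] 0 0 rfl rfl
    have h2 : value P F [vx 0, cr c 0] = _ * value P F [vx 0]
        + _ * value P F [vx 0, cap 0, cup 0] + 1 * value P F [vx 0, vx 0] :=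
      (hs.expands hP c).ctx F [vx 0] [] 0 0 rfl rfl
    have h5 : value P F [cap 0, cup 0, vx 0] = _ * value P F [cap 0, cup 0] :=
      (hc.loop_cup hP).ctx [cap 0] [] 0 0 rfl rfl F
    have h6 : value P F [vx 0, cap 0, cup 0] = _ * value P F [cap 0, cup 0] :=
      (hc.loop_cap hP).ctx [] [cup 0] 0 0 rfl rfl F
    change value P F [cr c 0, vx 0] = value P F [vx 0, cr c 0]
    rw [h1, h2, h5, h6]
  exact (comm.ctx (m := 2) (n := 2) [] [cr c.opp 0] 0 0 rfl rfl).trans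
    ((same_move_II hAB hP hc hs c).ctx (m := 2) (n := 2) [vx 0] [] 0 0 rfl rfl)

/-- A strand slides over or under a pair of horizontal arcs. -/
theorem same_slide_horizontal (hAB : A ≠ B) (hP : PlanarInvariant P)
    (hc : GraphicalCalculus A B a P) (hs : SkeinRelation A B P) (c : Crossing) :
    Same P (⟨[cr c 0, cr c 1, cap 0, cup 0], rfl⟩ : Tangle 3 3)
      ⟨[cap 1, cup 1, cr c 0, cr c 1], rfl⟩ := by
  have h := same_move_II hAB hP hc hs c
  have h' := same_move_II hAB hP hc hs c.opp
  rw [Crossing.opp_opp] at h'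
  have hcap : Same P (⟨[nd (.crossing c) 1, cap 0], rfl⟩ : Tangle 3 1)
      ⟨[nd (.crossing c.opp) 0, cap 1], rfl⟩ := by
    have := (hP.same (.turn_cap (.crossing c.opp))).symm
    simpa only [Node.rot, Crossing.opp_opp] using this
  have h1 : Same P (⟨[cr c 0, cr c 1, cap 0, cup 0], rfl⟩ : Tangle 3 3)
      ⟨[cap 1, cup 0], rfl⟩ :=
    -- The quarter turn at the maximum puts opposite crossings on top of each other, and move II
    -- removes them.
    (hcap.ctx (m := 3) (n := 3) [cr c 0] [cup 0] 0 0 rfl rfl).trans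
      (h.ctx (m := 3) (n := 3) [] [cap 1, cup 0] 0 1 rfl rfl)
  have h2 : Same P (⟨[cap 1, cup 1, cr c 0, cr c 1], rfl⟩ : Tangle 3 3)
      ⟨[cap 1, cup 0], rfl⟩ :=
    ((hP.same (.turn_cup (.crossing c))).ctx (m := 3) (n := 3)
      [cap 1] [cr c 1] 0 0 rfl rfl).trans
      (h'.ctx (m := 3) (n := 3) [cap 1, cup 0] [] 1 0 rfl rfl)
  exact h1.trans h2.symm

theorem same_move_IV (hAB : A ≠ B) (hP : PlanarInvariant P) (hc : GraphicalCalculus A B a P)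
    (hs : SkeinRelation A B P) (c : Crossing) :
    Same P (⟨[cr c 0, cr c 1, vx 0], rfl⟩ : Tangle 3 3) ⟨[vx 1, cr c 0, cr c 1], rfl⟩ := by
  intro F
  have e := hs.expands hP c
  have b := hc.expands_bigon
  have tcup := hP.same (.turn_cup .vertex)
  have tcap := hP.same (.turn_cap .vertex)
  have zl := hP.same .zigzag_left
  have zr := hP.same .zigzag_right
  have l0 : value P F [cr c 0, cr c 1, vx 0] = _ * value P F [cr c 1, vx 0]
      + _ * value P F [cap 0, cup 0, cr c 1, vx 0] + 1 * value P F [vx 0, cr c 1, vx 0] :=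
    e.ctx F [] [cr c 1, vx 0] 0 1 rfl rfl
  have l1 : value P F [cr c 1, vx 0] = _ * value P F [vx 0]
      + _ * value P F [cap 1, cup 1, vx 0] + 1 * value P F [vx 1, vx 0] :=
    e.ctx F [] [vx 0] 1 0 rfl rfl
  have l2 : value P F [cap 0, cup 0, cr c 1, vx 0] = _ * value P F [cap 0, cup 0, vx 0]
      + _ * value P F [cap 0, cup 0, cap 1, cup 1, vx 0]
      + 1 * value P F [cap 0, cup 0, vx 1, vx 0] :=
    e.ctx F [cap 0, cup 0] [vx 0] 1 0 rfl rfl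
  have l3 : value P F [vx 0, cr c 1, vx 0] = _ * value P F [vx 0, vx 0]
      + _ * value P F [vx 0, cap 1, cup 1, vx 0] + 1 * value P F [vx 0, vx 1, vx 0] :=
    e.ctx F [vx 0] [vx 0] 1 0 rfl rfl
  have l4 : value P F [cap 0, cup 0, vx 0] = _ * value P F [cap 0, cup 0] :=
    (hc.loop_cup hP).ctx [cap 0] [] 0 1 rfl rfl F
  have l5 : value P F [cap 0, cup 0, cap 1, cup 1, vx 0] = value P F [cap 0, cup 1, vx 0] :=
    zr.ctx [cap 0] [cup 1, vx 0] 0 0 rfl rfl F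
  -- A quarter turn at the minimum makes the two vertices bound a bigon; `r8` does the same at a
  -- maximum.
  have l6 : value P F [cap 0, cup 0, vx 1, vx 0] = value P F [cap 0, cup 1, vx 0, vx 0] :=
    (tcup.ctx [cap 0] [vx 0] 0 0 rfl rfl F).symm
  have l7 : value P F [cap 0, cup 1, vx 0, vx 0] = _ * value P F [cap 0, cup 1]
      + _ * value P F [cap 0, cup 1, cap 0, cup 0] + _ * value P F [cap 0, cup 1, vx 0] :=
    b.ctx F [cap 0, cup 1] [] 0 1 rfl rfl
  have l8 : value P F [cap 0, cup 1, cap 0, cup 0] = value P F [cap 0, cup 0] :=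
    zl.ctx [cap 0] [cup 0] 0 0 rfl rfl F
  have l9 : value P F [vx 0, vx 0] = _ * value P F [] + _ * value P F [cap 0, cup 0]
      + _ * value P F [vx 0] := b.ctx F [] [] 0 1 rfl rfl
  have r0 : value P F [vx 1, cr c 0, cr c 1] = _ * value P F [vx 1, cr c 1]
      + _ * value P F [vx 1, cap 0, cup 0, cr c 1] + 1 * value P F [vx 1, vx 0, cr c 1] :=
    e.ctx F [vx 1] [cr c 1] 0 1 rfl rfl
  have r1 : value P F [vx 1, cr c 1] = _ * value P F [vx 1]
      + _ * value P F [vx 1, cap 1, cup 1] + 1 * value P F [vx 1, vx 1] :=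
    e.ctx F [vx 1] [] 1 0 rfl rfl
  have r2 : value P F [vx 1, cap 0, cup 0, cr c 1] = _ * value P F [vx 1, cap 0, cup 0]
      + _ * value P F [vx 1, cap 0, cup 0, cap 1, cup 1]
      + 1 * value P F [vx 1, cap 0, cup 0, vx 1] :=
    e.ctx F [vx 1, cap 0, cup 0] [] 1 0 rfl rfl
  have r3 : value P F [vx 1, vx 0, cr c 1] = _ * value P F [vx 1, vx 0]
      + _ * value P F [vx 1, vx 0, cap 1, cup 1] + 1 * value P F [vx 1, vx 0, vx 1] :=
    e.ctx F [vx 1, vx 0] [] 1 0 rfl rfl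
  have r4 : value P F [vx 1, cap 1, cup 1] = _ * value P F [cap 1, cup 1] :=
    (hc.loop_cap hP).ctx [] [cup 1] 1 0 rfl rfl F
  have r5 : value P F [vx 1, cap 0, cup 0] = value P F [vx 0, cap 1, cup 0] :=
    (tcap.ctx [] [cup 0] 0 0 rfl rfl F).symm
  have r6 : value P F [vx 1, cap 0, cup 0, cap 1, cup 1] = value P F [vx 0, cap 1, cup 1] :=
    ((zr.ctx [vx 1, cap 0] [cup 1] 0 0 rfl rfl).trans
      (tcap.ctx (m := 3) (n := 3) [] [cup 1] 0 0 rfl rfl).symm) F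
  have r7 : value P F [vx 1, cap 0, cup 0, vx 1] = value P F [vx 0, cap 1, cup 1, vx 0] :=
    ((tcap.ctx (m := 3) (n := 3) [] [cup 0, vx 1] 0 0 rfl rfl).symm.trans
      (tcup.ctx (m := 3) (n := 3) [vx 0, cap 1] [] 0 0 rfl rfl).symm) F
  have r8 : value P F [vx 1, vx 0, cap 1, cup 1] = value P F [vx 1, vx 1, cap 0, cup 1] :=
    tcap.ctx [vx 1] [cup 1] 0 0 rfl rfl F
  have r9 : value P F [vx 1, vx 1, cap 0, cup 1] = _ * value P F [cap 0, cup 1]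
      + _ * value P F [cap 1, cup 1, cap 0, cup 1] + _ * value P F [vx 1, cap 0, cup 1] :=
    b.ctx F [] [cap 0, cup 1] 1 0 rfl rfl
  have r10 : value P F [cap 1, cup 1, cap 0, cup 1] = value P F [cap 1, cup 1] :=
    zl.ctx [cap 1] [cup 1] 0 0 rfl rfl F
  have r11 : value P F [vx 1, cap 0, cup 1] = value P F [vx 0, cap 1, cup 1] :=
    (tcap.ctx [] [cup 1] 0 0 rfl rfl F).symm
  have r12 : value P F [vx 1, vx 1] = _ * value P F [] + _ * value P F [cap 1, cup 1]
      + _ * value P F [vx 1] := b.ctx F [] [] 1 0 rfl rfl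
  -- The three-vertex terms are the two triangles, the only pictures that need the triangle
  -- relation.
  have t : value P F [vx 1, vx 0, vx 1] - value P F [vx 0, vx 1, vx 0] =
      A * B * (value P F [cap 1, cup 1, vx 0] - value P F [cap 0, cup 1, vx 0]
        + value P F [vx 0, cap 1, cup 1] - value P F [vx 0] + value P F [vx 1]
        - value P F [vx 0, cap 1, cup 0])
      + xi A B a * (value P F [cap 0, cup 0] - value P F [cap 1, cup 1]) := hc.triangle F
  rw [sub_eq_iff_eq_add, xi_eq hAB] at t
  change value P F [cr c 0, cr c 1, vx 0] = value P F [vx 1, cr c 0, cr c 1]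
  rw [l0, l1, l2, l3, l4, l5, l6, l7, l8, l9, r0, r1, r2, r3, r4, r5, r6, r7, r8, r9, r10, r11,
    r12, t]
  rw [← smoothing_mul (A := A) (B := B) c, ← smoothing_add (A := A) (B := B) c]
  ring

theorem same_move_III (hAB : A ≠ B) (hP : PlanarInvariant P) (hc : GraphicalCalculus A B a P)
    (hs : SkeinRelation A B P) (c y : Crossing) :
    Same P (⟨[cr c 0, cr c 1, cr y 0], rfl⟩ : Tangle 3 3) ⟨[cr y 1, cr c 0, cr c 1], rfl⟩ := by
  intro F
  have e := hs.expands hP y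
  have h1 : value P F [cr c 0, cr c 1, cr y 0] = _ * value P F [cr c 0, cr c 1]
      + _ * value P F [cr c 0, cr c 1, cap 0, cup 0] + 1 * value P F [cr c 0, cr c 1, vx 0] :=
    e.ctx F [cr c 0, cr c 1] [] 0 1 rfl rfl
  have h2 : value P F [cr y 1, cr c 0, cr c 1] = _ * value P F [cr c 0, cr c 1]
      + _ * value P F [cap 1, cup 1, cr c 0, cr c 1] + 1 * value P F [vx 1, cr c 0, cr c 1] :=
    e.ctx F [] [cr c 0, cr c 1] 1 0 rfl rfl
  have h3 : value P F [cr c 0, cr c 1, cap 0, cup 0] =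
      value P F [cap 1, cup 1, cr c 0, cr c 1] := same_slide_horizontal hAB hP hc hs c F
  have h4 : value P F [cr c 0, cr c 1, vx 0] = value P F [vx 1, cr c 0, cr c 1] :=
    same_move_IV hAB hP hc hs c F
  change value P F [cr c 0, cr c 1, cr y 0] = value P F [cr y 1, cr c 0, cr c 1]
  rw [h1, h2, h3, h4]

theorem same_of_reidemeisterRule (hAB : A ≠ B) (hP : PlanarInvariant P)
    (hc : GraphicalCalculus A B a P) (hs : SkeinRelation A B P) {m n : ℕ} {S T : Tangle m n}
    (h : ReidemeisterRule S T) : Same P S T := by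
  cases h with
  | move_II c => exact same_move_II hAB hP hc hs c
  | move_III c y => exact same_move_III hAB hP hc hs c y
  | move_IV c => exact same_move_IV hAB hP hc hs c
  | move_V c => exact same_move_V hAB hP hc hs c

theorem eq_of_regularlyIsotopic (hAB : A ≠ B) (hP : PlanarInvariant P)
    (hc : GraphicalCalculus A B a P) (hs : SkeinRelation A B P) {D E : Diagram}
    (h : RegularlyIsotopic D E) : P D = P E := by
  induction h with
  | rel D E h =>
    rcases h with h | ⟨m, n, F, S, T, h, rfl, rfl⟩
    · exact hP _ _ (Relation.EqvGen.rel _ _ h)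
    · exact same_of_reidemeisterRule hAB hP hc hs h F
  | refl => rfl
  | symm _ _ _ ih => exact ih.symm
  | trans _ _ _ _ _ ih ih' => exact ih.trans ih'

end Moves

end RigidGraph

theorem mainTheorem3 {K : Type*} [Field K] (A B a : K) (hAB : A ≠ B) (ha : a ≠ 0)
    (P : RigidGraph.Diagram → K)
    (hP : ∀ D E : RigidGraph.Diagram, RigidGraph.PlanarIsotopic D E → P D = P E)
    (hcalc : RigidGraph.GraphicalCalculus A B a P)
    (hskein : RigidGraph.SkeinRelation A B P) :
    (∀ D E : RigidGraph.Diagram, RigidGraph.RegularlyIsotopic D E → P D = P E) ∧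
    (∀ F : RigidGraph.Frame 1 1,
      P (F.fill (RigidGraph.curlRight (.crossing .slash))) =
          a * P (F.fill (RigidGraph.strands 1)) ∧
      P (F.fill (RigidGraph.curlLeft (.crossing .slash))) =
          a * P (F.fill (RigidGraph.strands 1)) ∧
      P (F.fill (RigidGraph.curlRight (.crossing .backslash))) =
          a⁻¹ * P (F.fill (RigidGraph.strands 1)) ∧
      P (F.fill (RigidGraph.curlLeft (.crossing .backslash))) =
          a⁻¹ * P (F.fill (RigidGraph.strands 1))) := by
  refine ⟨fun D E h => RigidGraph.eq_of_regularlyIsotopic hAB hP hcalc hskein h, fun F => ?_⟩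
  refine ⟨?_, ?_, ?_, ?_⟩
  · rw [RigidGraph.value_curlRight hP hcalc hskein .slash F]
    exact congrArg (· * _) (RigidGraph.mul_mu_add hAB)
  · rw [← RigidGraph.mul_mu_add (a := a) hAB, add_comm (A * _) B]
    -- `value_curlLeft` at a crossing evaluates the left curl of the opposite one.
    exact RigidGraph.value_curlLeft hP hcalc hskein .backslash F
  · rw [RigidGraph.value_curlRight hP hcalc hskein .backslash F]
    exact congrArg (· * _) (RigidGraph.mul_mu_add' hAB)
  · rw [← RigidGraph.mul_mu_add' (a := a) hAB, add_comm (B * _) A]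
    exact RigidGraph.value_curlLeft hP hcalc hskein .slash F
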